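/- Let the Fibonacci words over $\{a<b\}$ be $F_1=b$, $F_2=a$ and $F_k=F_{k-1}F_{k-2}$ for $k>2$, and let $n=|F_k|$ be the length of the word under consideration. For a string $T$ we use the following notions. A collage system is a finite sequence of rules, each defining a new nonterminal by $A\to a$ (a symbol), $A\to BC$, $A\to B^k$ with $k\ge 1$, or a truncation $A\to B^{[t]}$, $A\to{}^{[t]}B$ or $A\to B^{[t,t']}$ (the prefix of length $t$, the suffix of length $t$, or the substring from position $t$ to position $t'$ of the expansion of $B$, with $1\le t\le|exp(B)|$, respectively $1\le t\le t'\le|exp(B)|$), where $B,C$ are previously defined nonterminals. It generates $T$ if the last nonterminal expands to $T$, and its size is its number of rules. The expansions of nonterminals need not occur in $T$. A bidirectional scheme for $T$ is a partition of $T$ into phrases, each of which is a single explicit symbol or is copied from an equal substring of $T$ starting at another position, such that the map from target positions to source positions has no cycles; $b(T)$ is the smallest number of phrases of such a scheme. The lex-parse of $T$ cuts $T$ from left to right into phrases, where the phrase that starts at position $p$ has as its length the longest common prefix of the suffix starting at $p$ and its immediate predecessor in the lexicographic order of all nonempty suffixes of $T$ (a proper prefix being smaller), and is a single explicit symbol if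 that length is $0$ or there is no predecessor; $v(T)$ is its number of phrases. Then the even Fibonacci words (those $F_k$ with $k\ge 1$ even) form an infinite family of strings over an alphabet of size 2, and the following bounds hold with absolute constants. 1. Every collage system that generates a Fibonacci word $F_k$, $k\ge 1$, has size $c=\Omega(\log n)$. 2. $b(F_k)=O(1)$ for all $k\ge 1$, and $v(F_k)=O(1)$ for all even $k\ge 1$. 3. Consequently, for all even $k\ge 1$, every collage system that generates $F_k$ has size $c=\Omega(v(F_k)\log n)$ and $c=\Omega(b(F_k)\log n)$. -/

import Mathlib

/-! ### Fibonacci words -/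

/-- The Fibonacci words over the two-letter alphabet `{a, b} = {0, 1}`, `a < b`:
`F_1 = b`, `F_2 = a` and `F_k = F_{k-1} F_{k-2}` for `k > 2`.
(The value at index `0` is a placeholder.) -/
def fibWord : ℕ → List (Fin 2)
  | 0 => []
  | 1 => [1]
  | 2 => [0]
  | k + 3 => fibWord (k + 2) ++ fibWord (k + 1)

/-- The length of the `k`-th Fibonacci word is the `k`-th Fibonacci number. -/
theorem fibWord_length : ∀ k, (fibWord k).length = Nat.fib k
  | 0 => rfl
  | 1 => rfl
  | 2 => rfl
  | k + 3 => by
    rw [fibWord, List.length_append, fibWord_length (k + 2), fibWord_length (k + 1),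
      Nat.fib_add_two (n := k + 1), Nat.add_comm]

/-! ### Collage systems -/

/-- The right-hand sides of the rules of a collage system over the alphabet `α`, where `V` is the
set of nonterminals which may occur in the right-hand side. -/
inductive CollageRule (α V : Type) : Type
  /-- `A → a` -/
  | terminal (a : α)
  /-- `A → B C` -/
  | concat (B C : V)
  /-- `A → B ^ k` -/
  | power (B : V) (k : ℕ)
  /-- `A → B ^ [t]`, the prefix of length `t` of the expansion of `B` -/
  | trimPrefix (B : V) (t : ℕ)
  /-- `A → ^ [t] B`, the suffix of length `t` of the expansion of `B` -/
  | trimSuffix (B : V) (t : ℕ)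
  /-- `A → B ^ [t, t']`, the substring from position `t` to position `t'` (both included, positions
  counted from 1) of the expansion of `B` -/
  | trimSubstring (B : V) (t t' : ℕ)

namespace CollageRule

variable {α V : Type}

/-- The string produced by a rule, given the expansions of the nonterminals. -/
def eval (e : V → List α) : CollageRule α V → List α
  | terminal a => [a]
  | concat B C => e B ++ e C
  | power B k => (List.replicate k (e B)).flatten
  | trimPrefix B t => (e B).take t
  | trimSuffix B t => (e B).drop ((e B).length - t)
  | trimSubstring B t t' => ((e B).take t').drop (t - 1)

/-- The side conditions on the numbers in a rule. -/
def Valid (e : V → List α) : CollageRule α V → Prop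
  | terminal _ => True
  | concat _ _ => True
  | power _ k => 1 ≤ k
  | trimPrefix B t => 1 ≤ t ∧ t ≤ (e B).length
  | trimSuffix B t => 1 ≤ t ∧ t ≤ (e B).length
  | trimSubstring B t t' => 1 ≤ t ∧ t ≤ t' ∧ t' ≤ (e B).length

end CollageRule

/-- A sequence of `size` collage rules, where the `i`-th rule defines the `i`-th nonterminal and
may use only the nonterminals defined before. -/
structure CollageRules (α : Type) where
  size : ℕ
  rule : (i : Fin size) → CollageRule α (Fin i)

/-- The expansion of the `i`-th nonterminal. -/
def CollageRules.exp {α : Type} (S : CollageRules α) (i : ℕ) (hi : i < S.size) : List α :=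
  (S.rule ⟨i, hi⟩).eval fun j : Fin i => S.exp j (j.2.trans hi)
termination_by i
decreasing_by exact j.2

/-- A (general) collage system: concatenation, run-length, and truncation rules, all of which
satisfy their side conditions. Its size is its number of rules. Expansions of nonterminals need
not occur in the generated text. Substring truncations are allowed next to prefix and suffix
truncations, so that the so-called internal collage systems are covered too. -/
structure CollageSystem (α : Type) extends CollageRules α where
  valid : ∀ i : Fin size,
    (rule i).Valid fun j : Fin i => toCollageRules.exp j (j.2.trans i.2)

/-- `S` generates `T`: the expansion of the initial symbol, which is the last nonterminal,
is `T`. -/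
def CollageSystem.Generates {α : Type} (S : CollageSystem α) (T : List α) : Prop :=
  ∃ (i : ℕ) (hi : i < S.size), i + 1 = S.size ∧ S.exp i hi = T

/-! ### Bidirectional schemes -/

/-- A valid bidirectional scheme for the text `T` (positions are counted from 0). Phrase `i` is
`T[start i .. start i + len i - 1]`; `source i = some s` means that it is copied from
`T[s .. s + len i - 1]`, and `source i = none` that it is an explicit symbol. -/
structure BidirectionalScheme {α : Type} (T : List α) where
  size : ℕ
  start : Fin size → ℕ
  len : Fin size → ℕ
  source : Fin size → Option ℕ
  one_le_len : ∀ i, 1 ≤ len i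
  start_add_len_le : ∀ i, start i + len i ≤ T.length
  /-- The phrases partition the text. -/
  partition : ∀ p < T.length, ∃! i, start i ≤ p ∧ p < start i + len i
  len_explicit : ∀ i, source i = none → len i = 1
  source_ne : ∀ i s, source i = some s → s ≠ start i
  source_add_len_le : ∀ i s, source i = some s → s + len i ≤ T.length
  copy : ∀ i s, source i = some s → ∀ j < len i, T[s + j]? = T[start i + j]?
  /-- The map from target positions to source positions has no cycles. -/
  acyclic : ∀ p, ¬ Relation.TransGen
    (fun x y => ∃ i s j, source i = some s ∧ j < len i ∧ x = start i + j ∧ y = s + j) p p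

/-- Every text has a bidirectional scheme, all of whose phrases are explicit symbols. -/
theorem nonempty_bidirectionalScheme {α : Type} (T : List α) :
    Nonempty (BidirectionalScheme T) :=
  ⟨{ size := T.length
     start := fun i => i
     len := fun _ => 1
     source := fun _ => none
     one_le_len := fun _ => le_rfl
     start_add_len_le := fun i => i.2
     partition := fun p hp => ⟨⟨p, hp⟩, by simp, fun i hi => Fin.ext (by dsimp at hi ⊢; omega)⟩
     len_explicit := fun _ _ => rfl
     source_ne := fun _ _ h => by simp at h
     source_add_len_le := fun _ _ h => by simp at h
     copy := fun _ _ h => by simp at h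
     acyclic := fun p h => by
       obtain ⟨y, ⟨i, s, j, h, _⟩, _⟩ := Relation.TransGen.head'_iff.mp h
       simp at h }⟩

/-- The measure `b`: the smallest size of a bidirectional scheme for `T`. -/
noncomputable def bidirectionalSize {α : Type} (T : List α) : ℕ :=
  sInf (Set.range fun B : BidirectionalScheme T => B.size)

/-! ### The lex-parse -/

section LexParse

variable {α : Type} [LinearOrder α]

/-- The suffix array `SA` of `T`: the starting positions (counted from 0) of the nonempty suffixes
of `T`, sorted by the lexicographic order of the suffixes. A proper prefix of a string is smaller
than the string, as if `T` were followed by a terminator smaller than all symbols. -/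
def suffixArray (T : List α) : List ℕ :=
  (List.range T.length).mergeSort fun p q => decide (T.drop p ≤ T.drop q)

/-- The inverse suffix array `ISA`: the rank, counted from 0, of the suffix starting at `p`. -/
def inverseSuffixArray (T : List α) (p : ℕ) : ℕ :=
  (suffixArray T).idxOf p

/-- The length of the longest common prefix of two strings. -/
def lcpLength : List α → List α → ℕ
  | x :: xs, y :: ys => if x = y then lcpLength xs ys + 1 else 0
  | _, _ => 0

/-- The array `LCP`: the length of the longest common prefix of the suffix of rank `i` and the
suffix of rank `i - 1`, and `0` at the first rank. -/
def lcpArray (T : List α) (i : ℕ) : ℕ :=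
  if i = 0 then 0
  else lcpLength (T.drop ((suffixArray T).getD i 0)) (T.drop ((suffixArray T).getD (i - 1) 0))

/-- The length of the phrase of the lex-parse which starts at position `p`: it is
`LCP[ISA[p]]`, or `1` (an explicit symbol) if that value is `0`. -/
def lexPhraseLength (T : List α) (p : ℕ) : ℕ :=
  max 1 (lcpArray T (inverseSuffixArray T p))

/-- The starting positions of the phrases of the lex-parse of `T` from position `p` on. -/
def lexParseFrom (T : List α) (p : ℕ) : List ℕ :=
  if p < T.length then p :: lexParseFrom T (p + lexPhraseLength T p) else []
termination_by T.length - p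
decreasing_by
  have : 1 ≤ lexPhraseLength T p := le_max_left _ _
  omega

/-- The measure `v`: the number of phrases of the lex-parse of `T`. -/
def lexParseSize (T : List α) : ℕ :=
  (lexParseFrom T 0).length

end LexParse

/-! Everything is read off the infinite Fibonacci word `fibLetter`, through three facts. `F_m`
recurs at position `|F_{m+1}|` (`fibLetter_fib_succ_add`). Shifting by `|F_m|` changes nothing
before the last two letters of `F_{m+2}` (`fibLetter_add_fib`). The penultimate letter of `F_m`
depends only on the parity of `m` (`fibLetter_fib_sub_two`).

Lower bound on `c`: if the expansion of a nonterminal has the factor `F_j`, then an operand of its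
rule has the factor `F_{j-d}` with `d ≤ 4`. Truncation costs nothing; concatenation costs 2, since
`F_{j+2}` begins and ends with disjoint copies of `F_j`; a power costs 4, since `F_{j+4}` has no
short period. Hence the number of rules is linear in `k`, and `log n ≤ k`.

Upper bounds: shift and border split `F_k` into two long blocks and two single letters. For the
bidirectional scheme, both copies move positions by one rotation modulo `n`, which an explicit
letter cuts open. For the lex-parse, each long block also occurs at a smaller suffix, by parity for
one and because a proper prefix is smaller for the other. -/

/-! ### The letters of the infinite Fibonacci word -/

/-- The letter at position `n`, counted from `0`, of the infinite Fibonacci word. -/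
def fibLetter (n : ℕ) : Fin 2 := (fibWord (n + 2)).getD n 0

theorem fibWord_prefix (k d : ℕ) : fibWord (k + 2) <+: fibWord (k + 2 + d) := by
  induction d with
  | zero => exact List.prefix_rfl
  | succ d ih =>
    refine ih.trans ?_
    have : k + 2 + (d + 1) = (k + d) + 3 := by omega
    rw [this, fibWord, show k + 2 + d = k + d + 2 by omega]
    exact List.prefix_append _ _

/-- Ensures that the default value in `fibLetter` is never used. -/
theorem lt_fib_add_two (n : ℕ) : n < Nat.fib (n + 2) := by
  induction n with
  | zero => decide
  | succ n ih =>
    rw [show n + 1 + 2 = (n + 1) + 2 from rfl, Nat.fib_add_two]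
    have : 0 < Nat.fib (n + 1) := Nat.fib_pos.2 (by omega)
    rw [show n + 1 + 1 = n + 2 from rfl]
    omega

theorem fibWord_getElem? {k i : ℕ} (hk : 2 ≤ k) (hi : i < Nat.fib k) :
    (fibWord k)[i]? = some (fibLetter i) := by
  obtain ⟨k, rfl⟩ := Nat.exists_eq_add_of_le' hk
  have hi' : i < (fibWord (i + 2)).length := by
    rw [fibWord_length]; exact lt_fib_add_two i
  have h2 : (fibWord (i + 2))[i]? = some (fibLetter i) := by
    rw [fibLetter, List.getD_eq_getElem?_getD, List.getElem?_eq_getElem hi']; rfl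
  rw [← h2]
  rcases le_total k i with h | h
  · obtain ⟨d, rfl⟩ := Nat.exists_eq_add_of_le h
    have := fibWord_prefix k d
    rw [show k + d + 2 = k + 2 + d by omega]
    exact (List.getElem?_eq_getElem _).trans
      (List.prefix_iff_getElem?.1 this _ (by rwa [fibWord_length])).symm
  · obtain ⟨d, rfl⟩ := Nat.exists_eq_add_of_le h
    have := fibWord_prefix i d
    rw [show i + d + 2 = i + 2 + d by omega]
    exact (List.prefix_iff_getElem?.1 this i hi').trans (List.getElem?_eq_getElem _).symm

theorem fibLetter_fib_succ_add {m i : ℕ} (hm : 2 ≤ m) (hi : i < Nat.fib m) :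
    fibLetter (Nat.fib (m + 1) + i) = fibLetter i := by
  obtain ⟨m, rfl⟩ := Nat.exists_eq_add_of_le' hm
  have h : Nat.fib (m + 2 + 1) + i < Nat.fib (m + 2 + 2) := by
    rw [Nat.fib_add_two (n := m + 2)]; omega
  have h1 := fibWord_getElem? (by omega) h
  rw [show m + 2 + 2 = (m + 1) + 3 from rfl, fibWord, List.getElem?_append_right
    (by rw [fibWord_length]; exact Nat.le_add_right _ _), fibWord_length,
    show m + 1 + 2 = m + 2 + 1 from rfl, Nat.add_sub_cancel_left,
    fibWord_getElem? (by omega) hi] at h1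
  exact (Option.some.inj h1).symm

/-- `F_m F_{m+1}` and `F_{m+1} F_m` differ only in their last two letters. In the induction, once
`i` passes the first `|F_m|` letters, both sides reduce to position `i - |F_m|`, where the previous
case applies. -/
theorem fibLetter_add_fib {m i : ℕ} (hm : 2 ≤ m) (hi : i + 2 < Nat.fib (m + 1)) :
    fibLetter (i + Nat.fib m) = fibLetter i := by
  induction m, hm using Nat.le_induction generalizing i with
  | base => exact absurd hi (by simp [Nat.fib])
  | succ m hm ih =>
    have hf : Nat.fib (m + 2) = Nat.fib m + Nat.fib (m + 1) := Nat.fib_add_two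
    rcases lt_or_ge i (Nat.fib m) with h | h
    · rw [add_comm, fibLetter_fib_succ_add hm h]
    · obtain ⟨j, rfl⟩ := Nat.exists_eq_add_of_le h
      rw [show Nat.fib m + j + Nat.fib (m + 1) = Nat.fib (m + 1 + 1) + j by
          rw [show m + 1 + 1 = m + 2 from rfl, hf]; omega,
        fibLetter_fib_succ_add (by omega) (by rw [show m + 1 + 1 = m + 2 from rfl] at hi; omega),
        add_comm (Nat.fib m) j, ih]
      rw [show m + 1 + 1 = m + 2 from rfl] at hi
      omega

theorem two_le_fib {m : ℕ} (hm : 3 ≤ m) : 2 ≤ Nat.fib m :=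
  (show Nat.fib 3 = 2 from rfl) ▸ Nat.fib_mono hm

theorem fibLetter_fib_sub_two {m : ℕ} (hm : 3 ≤ m) :
    fibLetter (Nat.fib m - 2) = if Even m then 1 else 0 := by
  induction m using Nat.strong_induction_on with
  | _ m ih =>
    rcases (by omega : m = 3 ∨ m = 4 ∨ 5 ≤ m) with rfl | rfl | h
    · decide
    · decide
    · obtain ⟨m, rfl⟩ := Nat.exists_eq_add_of_le' (show 2 ≤ m by omega)
      have h2 := two_le_fib (show 3 ≤ m by omega)
      rw [Nat.fib_add_two, add_comm, Nat.add_sub_assoc h2,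
        fibLetter_fib_succ_add (by omega) (by omega), ih m (by omega) (by omega)]
      simp [Nat.even_add]

/-- The word `F_{j+1}` has no period `p ≤ |F_j| - 2`. -/
theorem fibLetter_not_periodic {j p : ℕ} (hj : 3 ≤ j) (hp : 0 < p) (hpj : p + 2 ≤ Nat.fib j) :
    ¬ ∀ i, i + p < Nat.fib (j + 1) → fibLetter i = fibLetter (i + p) := by
  intro h
  obtain ⟨m, rfl⟩ := Nat.exists_eq_add_of_le' (show 1 ≤ j by omega)
  have hf : Nat.fib (m + 1 + 1) = Nat.fib m + Nat.fib (m + 1) := Nat.fib_add_two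
  -- Two positions with equal letters, `|F_m|` apart, which a period `p` would carry to the
  -- penultimate letters of `F_{m+1}` and `F_{m+2}`; these differ by parity.
  have e1 := h (Nat.fib (m + 1) - 2 - p) (by omega)
  have e2 := h (Nat.fib (m + 1) - 2 - p + Nat.fib m) (by omega)
  rw [fibLetter_add_fib (by omega) (by omega), e1,
    show Nat.fib (m + 1) - 2 - p + p = Nat.fib (m + 1) - 2 by omega,
    show Nat.fib (m + 1) - 2 - p + Nat.fib m + p = Nat.fib (m + 1 + 1) - 2 by omega,
    fibLetter_fib_sub_two hj, fibLetter_fib_sub_two (by omega)] at e2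
  by_cases he : Even (m + 1) <;> simp [he, Nat.even_add_one] at e2

/-! ### Collage systems generating Fibonacci words -/

/-- The `j`-th Fibonacci word, `j ≥ 2`, is a factor of `T`. -/
def ContainsFib (T : List (Fin 2)) (j : ℕ) : Prop :=
  ∃ o, o + Nat.fib j ≤ T.length ∧ ∀ i < Nat.fib j, T[o + i]? = some (fibLetter i)

theorem containsFib_fibWord {k : ℕ} (hk : 2 ≤ k) : ContainsFib (fibWord k) k :=
  ⟨0, by simp [fibWord_length], fun i hi => by rw [zero_add]; exact fibWord_getElem? hk hi⟩

theorem ContainsFib.of_infix {X Y : List (Fin 2)} {j : ℕ} (h : ContainsFib X j)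
    (hXY : X <:+: Y) : ContainsFib Y j := by
  obtain ⟨A, B, rfl⟩ := hXY
  obtain ⟨o, ho, h⟩ := h
  refine ⟨A.length + o, by simp; omega, fun i hi => ?_⟩
  rw [List.append_assoc, List.getElem?_append_right (by omega),
    List.getElem?_append_left (by omega), ← h i hi]
  congr 1; omega

/-- The copies of `F_j` at both ends of `F_{j+2}` are disjoint, so the cut between `X` and `Y`
misses one of them. -/
theorem ContainsFib.append {X Y : List (Fin 2)} {j : ℕ} (hj : 2 ≤ j)
    (h : ContainsFib (X ++ Y) (j + 2)) : ContainsFib X j ∨ ContainsFib Y j := by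
  obtain ⟨o, ho, h⟩ := h
  have hf : Nat.fib (j + 2) = Nat.fib j + Nat.fib (j + 1) := Nat.fib_add_two
  have hm : Nat.fib j ≤ Nat.fib (j + 1) := Nat.fib_mono (by omega)
  rw [List.length_append] at ho
  rcases le_or_gt (o + Nat.fib j) X.length with hX | hX
  · refine .inl ⟨o, hX, fun i hi => ?_⟩
    rw [← h i (by omega), List.getElem?_append_left (by omega)]
  · refine .inr ⟨o + Nat.fib (j + 1) - X.length, by omega, fun i hi => ?_⟩
    have := h (Nat.fib (j + 1) + i) (by omega)
    rw [fibLetter_fib_succ_add hj hi, List.getElem?_append_right (by omega)] at this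
    rw [← this]
    congr 1; omega

theorem getElem?_flatten_replicate {α : Type} (B : List α) (k i : ℕ) (hi : i < k * B.length) :
    (List.replicate k B).flatten[i]? = B[i % B.length]? := by
  induction k generalizing i with
  | zero => omega
  | succ k ih =>
    rw [List.replicate_succ, List.flatten_cons]
    rw [add_mul, one_mul] at hi
    rcases lt_or_ge i B.length with h | h
    · rw [List.getElem?_append_left h, Nat.mod_eq_of_lt h]
    · rw [List.getElem?_append_right h, ih _ (by omega), ← Nat.mod_eq_sub_mod h]

theorem ContainsFib.power {B : List (Fin 2)} {k j : ℕ} (hj : 2 ≤ j)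
    (h : ContainsFib (List.replicate k B).flatten (j + 4)) : ContainsFib B j := by
  obtain ⟨o, ho, h⟩ := h
  have f4 : Nat.fib (j + 4) = Nat.fib (j + 2) + Nat.fib (j + 3) := Nat.fib_add_two
  have f3 : Nat.fib (j + 3) = Nat.fib (j + 1) + Nat.fib (j + 2) := Nat.fib_add_two
  have f2 : Nat.fib (j + 2) = Nat.fib j + Nat.fib (j + 1) := Nat.fib_add_two
  have f0 : 0 < Nat.fib j := Nat.fib_pos.2 (by omega)
  have f1 : Nat.fib j ≤ Nat.fib (j + 1) := Nat.fib_mono (by omega)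
  have hlen : (List.replicate k B).flatten.length = k * B.length := by simp
  rw [hlen] at ho
  have hp : 0 < B.length := by
    rcases Nat.eq_zero_or_pos B.length with h0 | h0
    · rw [h0] at ho; omega
    · exact h0
  have hB : ∀ i < Nat.fib (j + 4), B[(o + i) % B.length]? = some (fibLetter i) := fun i hi => by
    rw [← h i hi, getElem?_flatten_replicate _ _ _ (by omega)]
  -- Otherwise `|B|` would be a period of `F_{j+4}` that is at most `|F_{j+3}| - 2`.
  have hlong : Nat.fib (j + 2) ≤ B.length := by
    by_contra hlt
    refine fibLetter_not_periodic (j := j + 3) (by omega) hp (by omega) fun i hi => ?_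
    have e1 := hB i (by rw [show j + 3 + 1 = j + 4 from rfl] at hi; omega)
    have e2 := hB (i + B.length) hi
    rw [← add_assoc, Nat.add_mod_right, e1] at e2
    exact Option.some.inj e2
  have hr : o % B.length < B.length := Nat.mod_lt _ hp
  have hBr : ∀ i < Nat.fib (j + 4), B[(o % B.length + i) % B.length]? = some (fibLetter i) :=
    fun i hi => by rw [Nat.mod_add_mod]; exact hB i hi
  -- The prefix `F_{j+2}` of the occurrence is no longer than `B`, so it meets at most one boundary
  -- between copies of `B`, and that boundary misses the first or the last `F_j`.
  rcases le_or_gt (o % B.length + Nat.fib j) B.length with hle | hgt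
  · refine ⟨o % B.length, hle, fun i hi => ?_⟩
    rw [← hBr i (by omega), Nat.mod_eq_of_lt (a := o % B.length + i) (by omega)]
  · refine ⟨o % B.length + Nat.fib (j + 1) - B.length, by omega, fun i hi => ?_⟩
    have hlt : o % B.length + Nat.fib (j + 1) - B.length + i < B.length := by omega
    rw [← fibLetter_fib_succ_add hj hi, ← hBr _ (by omega),
      show o % B.length + (Nat.fib (j + 1) + i) =
        o % B.length + Nat.fib (j + 1) - B.length + i + B.length by omega,
      Nat.add_mod_right, Nat.mod_eq_of_lt hlt]

/-- Each rule lowers the index by at most 4. The constant 5 keeps `j - 4 ≥ 2` in the inductive step,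
as the power case requires. -/
theorem CollageRules.le_of_containsFib_exp (S : CollageRules (Fin 2)) (i : ℕ) (hi : i < S.size)
    {j : ℕ} (h : ContainsFib (S.exp i hi) j) : j ≤ 4 * i + 5 := by
  induction i using Nat.strong_induction_on generalizing j with
  | _ i ih =>
    by_contra hj
    rw [CollageRules.exp] at h
    have key : ∀ (B : Fin i) {d : ℕ}, d ≤ 4 →
        ContainsFib (S.exp B (B.2.trans hi)) (j - d) → False := fun B d hd hB => by
      have h1 := ih B B.2 (B.2.trans hi) hB
      have h2 := B.2
      omega
    cases hr : S.rule ⟨i, hi⟩ with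
    | terminal a =>
      rw [hr] at h
      obtain ⟨o, ho, -⟩ := h
      have := two_le_fib (show 3 ≤ j by omega)
      simp only [CollageRule.eval, List.length_singleton] at ho
      omega
    | concat B C =>
      rw [hr] at h
      rw [show j = j - 2 + 2 by omega] at h
      rcases h.append (by omega) with h | h
      · exact key B (by omega) h
      · exact key C (by omega) h
    | power B k =>
      rw [hr] at h
      rw [show j = j - 4 + 4 by omega] at h
      exact key B (by omega) (h.power (by omega))
    | trimPrefix B t =>
      rw [hr] at h
      exact key B (d := 0) (by omega) (h.of_infix (List.take_prefix _ _).isInfix)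
    | trimSuffix B t =>
      rw [hr] at h
      exact key B (d := 0) (by omega) (h.of_infix (List.drop_suffix _ _).isInfix)
    | trimSubstring B t t' =>
      rw [hr] at h
      exact key B (d := 0) (by omega) (h.of_infix
        ((List.drop_suffix _ _).isInfix.trans (List.take_prefix _ _).isInfix))

theorem CollageSystem.le_size_of_generates_fibWord {S : CollageSystem (Fin 2)} {k : ℕ}
    (h : S.Generates (fibWord k)) : k ≤ 5 * S.size := by
  obtain ⟨i, hi, hS, h⟩ := h
  rcases lt_or_ge k 2 with hk | hk
  · omega
  · have := S.le_of_containsFib_exp i hi (h ▸ containsFib_fibWord hk)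
    omega

theorem fib_le_two_pow (k : ℕ) : Nat.fib k ≤ 2 ^ k := by
  induction k using Nat.twoStepInduction with
  | zero => decide
  | one => decide
  | more k h1 h2 =>
    rw [Nat.fib_add_two]
    rw [pow_succ] at h2 ⊢
    rw [pow_succ]
    omega

theorem log_fib_le (k : ℕ) : Real.log (Nat.fib k : ℝ) ≤ k := by
  rcases Nat.eq_zero_or_pos k with rfl | hk
  · simp
  have h : (Nat.fib k : ℝ) ≤ 2 ^ k := by
    exact_mod_cast fib_le_two_pow k
  have h0 : (0 : ℝ) < Nat.fib k := by exact_mod_cast Nat.fib_pos.2 hk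
  calc Real.log (Nat.fib k : ℝ) ≤ Real.log (2 ^ k) := Real.log_le_log h0 h
    _ = k * Real.log 2 := Real.log_pow _ _
    _ ≤ k * 1 := by
      gcongr
      linarith [Real.log_two_lt_d9]
    _ = k := mul_one _

theorem CollageSystem.log_length_le_size {S : CollageSystem (Fin 2)} {k : ℕ}
    (h : S.Generates (fibWord k)) :
    1 / 5 * Real.log ((fibWord k).length : ℝ) ≤ (S.size : ℝ) := by
  have h1 : (k : ℝ) ≤ 5 * S.size := by exact_mod_cast le_size_of_generates_fibWord h
  have h2 := log_fib_le k
  rw [fibWord_length]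
  linarith

/-! ### The lex-parse -/

section LexParseBounds

variable {α : Type} [LinearOrder α]

theorem length_le_lcpLength_append (w x y : List α) :
    w.length ≤ lcpLength (w ++ x) (w ++ y) := by
  induction w with
  | nil => simp
  | cons a w ih => simpa [lcpLength] using ih

theorem append_lt_append_left {x y : List α} (h : x < y) (w : List α) : w ++ x < w ++ y := by
  induction w with
  | nil => simpa using h
  | cons a w ih => exact List.Lex.cons ih

theorem cons_le_cons_cases {a b : α} {x y : List α} (h : a :: x ≤ b :: y) :
    a < b ∨ a = b ∧ x ≤ y := by
  rw [← not_lt, List.cons_lt_cons_iff] at h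
  push Not at h
  rcases lt_or_eq_of_le h.1 with h1 | h1
  · exact .inl h1
  · exact .inr ⟨h1, h.2 h1.symm⟩

theorem lcpLength_le_of_le_of_le {x y z : List α} (hxy : x ≤ y) (hyz : y ≤ z) :
    lcpLength x z ≤ lcpLength y z := by
  induction x generalizing y z with
  | nil => simp [lcpLength]
  | cons a x ih =>
    cases z with
    | nil => simp [lcpLength]
    | cons c z =>
      cases y with
      | nil => exact absurd hxy (by simp)
      | cons b y =>
        replace hxy := cons_le_cons_cases hxy
        replace hyz := cons_le_cons_cases hyz
        by_cases hac : a = c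
        · subst hac
          rcases hxy with h1 | ⟨rfl, h1⟩
          · rcases hyz with h2 | ⟨rfl, h2⟩
            · exact absurd (h1.trans h2) (lt_irrefl _)
            · exact absurd h1 (lt_irrefl _)
          · rcases hyz with h2 | ⟨-, h2⟩
            · exact absurd h2 (lt_irrefl _)
            · simpa [lcpLength] using ih h1 h2
        · simp [lcpLength, hac]

theorem lcpLength_comm (x y : List α) : lcpLength x y = lcpLength y x := by
  induction x generalizing y with
  | nil => cases y <;> rfl
  | cons a x ih =>
    cases y with
    | nil => rfl
    | cons b y => simp only [lcpLength, ih y, eq_comm]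

theorem suffixArray_perm (T : List α) : (suffixArray T).Perm (List.range T.length) :=
  List.mergeSort_perm _ _

theorem suffixArray_pairwise (T : List α) :
    (suffixArray T).Pairwise fun p q => T.drop p ≤ T.drop q := by
  have := List.pairwise_mergeSort (le := fun p q => decide (T.drop p ≤ T.drop q))
    (fun a b c h1 h2 => by
      simp only [decide_eq_true_eq] at h1 h2 ⊢; exact h1.trans h2)
    (fun a b => by simpa using le_total (T.drop a) (T.drop b)) (List.range T.length)
  simpa [suffixArray] using this

/-- A phrase of the lex-parse is at least as long as the longest common prefix with any smaller
suffix. -/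
theorem lcpLength_le_lexPhraseLength {T : List α} {p q : ℕ} (hp : p < T.length)
    (hq : q < T.length) (h : T.drop q < T.drop p) :
    lcpLength (T.drop q) (T.drop p) ≤ lexPhraseLength T p := by
  have hpm : p ∈ suffixArray T := (suffixArray_perm T).mem_iff.2 (List.mem_range.2 hp)
  have hqm : q ∈ suffixArray T := (suffixArray_perm T).mem_iff.2 (List.mem_range.2 hq)
  have hsort := List.pairwise_iff_getElem.1 (suffixArray_pairwise T)
  have hi : (suffixArray T).idxOf p < (suffixArray T).length := List.idxOf_lt_length_of_mem hpm
  have hj : (suffixArray T).idxOf q < (suffixArray T).length := List.idxOf_lt_length_of_mem hqm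
  have gi : (suffixArray T)[(suffixArray T).idxOf p] = p := List.getElem_idxOf hi
  have gj : (suffixArray T)[(suffixArray T).idxOf q] = q := List.getElem_idxOf hj
  have hji : (suffixArray T).idxOf q < (suffixArray T).idxOf p := by
    rcases lt_trichotomy ((suffixArray T).idxOf q) ((suffixArray T).idxOf p) with h1 | h1 | h1
    · exact h1
    · simp only [← h1] at gi
      rw [← gi, gj] at h
      exact absurd h (lt_irrefl _)
    · have := hsort _ _ hi hj h1
      rw [gi, gj] at this
      exact absurd h (not_lt.2 this)
  have hi1 : (suffixArray T).idxOf p - 1 < (suffixArray T).length := by omega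
  -- The immediate predecessor `r` lies between `q` and `p` in suffix order, so it shares at least
  -- as much with `p` as `q` does.
  set r := (suffixArray T)[(suffixArray T).idxOf p - 1] with hr
  have hrp : T.drop r ≤ T.drop p := by
    have := hsort _ _ hi1 hi (by omega)
    rwa [gi] at this
  have hqr : T.drop q ≤ T.drop r := by
    rcases eq_or_lt_of_le (show (suffixArray T).idxOf q ≤ (suffixArray T).idxOf p - 1 by omega)
      with h1 | h1
    · simp only [h1] at gj
      rw [hr, gj]
    · have := hsort _ _ hj hi1 h1
      rwa [gj] at this
  have hrp' : lcpLength (T.drop q) (T.drop p) ≤ lcpLength (T.drop r) (T.drop p) :=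
    lcpLength_le_of_le_of_le hqr hrp
  refine hrp'.trans ((lcpLength_comm _ _).le.trans ?_)
  unfold lexPhraseLength lcpArray inverseSuffixArray
  rw [if_neg (by omega), List.getD_eq_getElem _ _ hi, List.getD_eq_getElem _ _ hi1, gi, ← hr]
  exact le_max_right _ _

/-- Dropping the same part of `w` from both suffixes preserves their order, so a phrase starting
anywhere inside this copy of `w` reaches its end. -/
theorem le_add_lexPhraseLength {T w x y : List α} {p q i : ℕ} (hq : T.drop q = w ++ x)
    (hp : T.drop p = w ++ y) (hxy : x < y) (hpi : p ≤ i) (hi : i < p + w.length) :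
    p + w.length ≤ i + lexPhraseLength T i := by
  obtain ⟨d, rfl⟩ := Nat.exists_eq_add_of_le hpi
  have hq' : T.drop (q + d) = w.drop d ++ x := by
    rw [← List.drop_drop, hq, List.drop_append_of_le_length (by omega)]
  have hp' : T.drop (p + d) = w.drop d ++ y := by
    rw [← List.drop_drop, hp, List.drop_append_of_le_length (by omega)]
  have lq := congrArg List.length hq'
  have lp := congrArg List.length hp'
  simp only [List.length_drop, List.length_append] at lq lp
  have h1 := lcpLength_le_lexPhraseLength (T := T) (p := p + d) (q := q + d) (by omega) (by omega)
    (by rw [hq', hp']; exact append_lt_append_left hxy _)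
  have h2 := length_le_lcpLength_append (w.drop d) x y
  rw [← hq', ← hp', List.length_drop] at h2
  omega

/-- Counts phrases block by block from the right. Quantifying over all starting points avoids
computing where phrases actually begin. -/
theorem lexParseFrom_length_le_succ {T : List α} {x y c : ℕ}
    (hx : ∀ p, x ≤ p → (lexParseFrom T p).length ≤ c)
    (hy : ∀ p, y ≤ p → p < x → x ≤ p + lexPhraseLength T p) :
    ∀ p, y ≤ p → (lexParseFrom T p).length ≤ c + 1 := by
  intro p hp
  rcases lt_or_ge p x with h | h
  · rw [lexParseFrom]
    split_ifs
    · simpa using hx _ (hy p hp h)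
    · simp
  · exact (hx p h).trans (Nat.le_succ c)

theorem lexParseFrom_length_eq_zero {T : List α} {p : ℕ} (hp : T.length ≤ p) :
    (lexParseFrom T p).length = 0 := by
  rw [lexParseFrom, if_neg (by omega)]; rfl

end LexParseBounds

theorem lexParseSize_fibWord_le {k : ℕ} (hk : 5 ≤ k) (he : Even k) :
    lexParseSize (fibWord k) ≤ 4 := by
  obtain ⟨m, rfl⟩ := Nat.exists_eq_add_of_le' (show 3 ≤ k by omega)
  set T := fibWord (m + 3) with hT
  have f1 : Nat.fib (m + 2 + 1) = Nat.fib (m + 1) + Nat.fib (m + 2) := Nat.fib_add_two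
  have h1 : 1 ≤ Nat.fib (m + 1) := Nat.fib_pos.2 (by omega)
  have h2 : 2 ≤ Nat.fib (m + 2) := two_le_fib (by omega)
  have hlen : T.length = Nat.fib (m + 1) + Nat.fib (m + 2) := by rw [hT, fibWord_length, ← f1]
  have hget : ∀ i < Nat.fib (m + 1) + Nat.fib (m + 2), T[i]? = some (fibLetter i) := fun i hi =>
    fibWord_getElem? (by omega) (by rw [show m + 3 = m + 2 + 1 from rfl, f1]; exact hi)
  have c0 : ∀ p, T.length ≤ p → (lexParseFrom T p).length ≤ 0 := fun p hp =>
    (lexParseFrom_length_eq_zero hp).le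
  have step : ∀ p, 1 ≤ lexPhraseLength T p := fun p => le_max_left _ _
  have c1 := lexParseFrom_length_le_succ (y := T.length - 1) c0 fun p h3 h4 => by
    have := step p; omega
  have c2 := lexParseFrom_length_le_succ (y := T.length - 2) c1 fun p h3 h4 => by
    have := step p; omega
  -- The compared suffix is `T` itself. After the common part come the penultimate letters of
  -- `F_{m+2}` and `F_{m+3}`, which are `a < b` exactly because `m + 3` is even.
  have c3 := lexParseFrom_length_le_succ (y := Nat.fib (m + 1)) c2 fun p h3 h4 => by
    have hw : (T.take (Nat.fib (m + 2) - 2)).length = Nat.fib (m + 2) - 2 := by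
      rw [List.length_take]; omega
    have hq : T.drop 0 = T.take (Nat.fib (m + 2) - 2) ++ T.drop (Nat.fib (m + 2) - 2) := by simp
    have hp : T.drop (Nat.fib (m + 1)) = T.take (Nat.fib (m + 2) - 2) ++ T.drop (T.length - 2) := by
      rw [← List.take_append_drop (Nat.fib (m + 2) - 2) (T.drop (Nat.fib (m + 1))),
        List.drop_drop, show Nat.fib (m + 1) + (Nat.fib (m + 2) - 2) = T.length - 2 by omega]
      congr 1
      refine List.ext_getElem? fun i => ?_
      rcases lt_or_ge i (Nat.fib (m + 2) - 2) with hi | hi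
      · rw [List.getElem?_take_of_lt hi, List.getElem?_take_of_lt hi, List.getElem?_drop,
          hget _ (by omega), hget _ (by omega), add_comm,
          fibLetter_add_fib (by omega) (by rw [show m + 1 + 1 = m + 2 from rfl]; omega)]
      · rw [List.getElem?_take_eq_none hi, List.getElem?_take_eq_none hi]
    have hxy : T.drop (Nat.fib (m + 2) - 2) < T.drop (T.length - 2) := by
      rw [List.drop_eq_getElem_cons (show Nat.fib (m + 2) - 2 < T.length by omega),
        List.drop_eq_getElem_cons (show T.length - 2 < T.length by omega)]
      refine List.Lex.rel ?_
      have e1 := hget (Nat.fib (m + 2) - 2) (by omega)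
      have e2 := hget (T.length - 2) (by omega)
      rw [List.getElem?_eq_getElem (by omega), fibLetter_fib_sub_two (by omega), if_neg
        (by simpa [Nat.even_add_one] using he)] at e1
      have e3 : fibLetter (T.length - 2) = 1 := by
        rw [hlen, ← f1, fibLetter_fib_sub_two (by omega), if_pos he]
      rw [List.getElem?_eq_getElem (by omega), e3] at e2
      rw [Option.some.inj e1, Option.some.inj e2]
      decide
    have := le_add_lexPhraseLength hq hp hxy h3 (by omega)
    omega
  -- The border `F_{m+1}` is a suffix of `T` and a proper prefix of it, hence smaller.
  have c4 := lexParseFrom_length_le_succ (y := 0) c3 fun p h3 h4 => by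
    have hw : (T.drop (Nat.fib (m + 2))).length = Nat.fib (m + 1) := by
      rw [List.length_drop]; omega
    have hp : T.drop 0 = T.drop (Nat.fib (m + 2)) ++ T.drop (Nat.fib (m + 1)) := by
      rw [List.drop_zero]
      conv_lhs => rw [← List.take_append_drop (Nat.fib (m + 1)) T]
      congr 1
      refine List.ext_getElem? fun i => ?_
      rcases lt_or_ge i (Nat.fib (m + 1)) with hi | hi
      · rw [List.getElem?_take_of_lt hi, List.getElem?_drop, hget _ (by omega), hget _ (by omega),
          fibLetter_fib_succ_add (by omega) hi]
      · rw [List.getElem?_take_eq_none hi, List.getElem?_eq_none (by omega)]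
    have hxy : [] < T.drop (Nat.fib (m + 1)) := by
      rw [List.drop_eq_getElem_cons (by omega)]
      exact List.Lex.nil
    have := le_add_lexPhraseLength (List.append_nil _).symm hp hxy h3 (by omega)
    omega
  exact c4 0 le_rfl

theorem lexParseSize_le_length {α : Type} [LinearOrder α] (T : List α) :
    lexParseSize T ≤ T.length := by
  have : ∀ d p, T.length ≤ p + d → (lexParseFrom T p).length ≤ d := by
    intro d
    induction d with
    | zero => intro p hp; exact (lexParseFrom_length_eq_zero hp).le
    | succ d ih =>
      intro p hp
      rw [lexParseFrom]
      split_ifs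
      · have h1 : 1 ≤ lexPhraseLength T p := le_max_left _ _
        simpa using ih (p + lexPhraseLength T p) (by omega)
      · simp
  exact this _ 0 (by omega)

/-! ### A bidirectional scheme with four phrases -/

theorem bidirectionalSize_le {α : Type} {T : List α} (B : BidirectionalScheme T) :
    bidirectionalSize T ≤ B.size :=
  Nat.sInf_le ⟨B, rfl⟩

theorem bidirectionalSize_le_length {α : Type} (T : List α) :
    bidirectionalSize T ≤ T.length := by
  refine bidirectionalSize_le
    { size := T.length
      start := fun i => i
      len := fun _ => 1
      source := fun _ => none
      one_le_len := fun _ => le_rfl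
      start_add_len_le := fun i => i.2
      partition := fun p hp => ⟨⟨p, hp⟩, by simp, fun i hi => Fin.ext (by dsimp at hi ⊢; omega)⟩
      len_explicit := fun _ _ => rfl
      source_ne := fun _ _ h => by simp at h
      source_add_len_le := fun _ _ h => by simp at h
      copy := fun _ _ h => by simp at h
      acyclic := fun p h => by
        obtain ⟨y, ⟨i, s, j, h, _⟩, _⟩ := Relation.TransGen.head'_iff.mp h
        simp at h }

/-- The rotation by `a` modulo `n`, with `a` coprime to `n`, has no cycles once the edge that
leaves some position `c < n` is removed. -/
theorem rotation_acyclic {a n c : ℕ} (hn : 1 < n) (hac : a.Coprime n) (hc : c < n)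
    {r : ℕ → ℕ → Prop}
    (hr : ∀ x y, r x y → x < n ∧ x ≠ c ∧ (y : ZMod n) = x + a) (p : ℕ) :
    ¬ Relation.TransGen r p p := by
  have : NeZero n := ⟨by omega⟩
  have : Fact (1 < n) := ⟨hn⟩
  have hg : (a : ZMod n) * (a : ZMod n)⁻¹ = 1 := ZMod.coe_mul_inv_eq_one a hac
  -- `h x` counts the rotation steps from `c + a` to `x`. It grows by one along each edge and could
  -- wrap around only on leaving `c`, where it equals `-1`.
  let h : ℕ → ZMod n := fun x => ((x : ZMod n) - c) * (a : ZMod n)⁻¹ - 1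
  have hstep : ∀ x y, r x y → (h x).val < (h y).val := by
    intro x y hxy
    obtain ⟨hx, hxc, hy⟩ := hr x y hxy
    have e : h y = h x + 1 := by
      simp only [h, hy]
      linear_combination hg
    have hne : (h x).val + 1 ≠ n := by
      intro hv
      have h0 : h x + 1 = 0 := by
        have : (((h x).val + 1 : ℕ) : ZMod n) = 0 := by rw [hv, ZMod.natCast_self]
        simpa using this
      have h1 : (x : ZMod n) = c := by
        simp only [h] at h0
        linear_combination (a : ZMod n) * h0 - ((x : ZMod n) - c) * hg
      rw [ZMod.natCast_eq_natCast_iff', Nat.mod_eq_of_lt hx, Nat.mod_eq_of_lt hc] at h1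
      exact hxc h1
    have hlt := ZMod.val_lt (h x)
    rw [e, ZMod.val_add_of_lt (by rw [ZMod.val_one]; omega), ZMod.val_one]
    omega
  have htrans : ∀ x y, Relation.TransGen r x y → (h x).val < (h y).val := by
    intro x y hxy
    induction hxy with
    | single h1 => exact hstep _ _ h1
    | tail _ h1 ih => exact ih.trans (hstep _ _ h1)
  exact fun hp => lt_irrefl _ (htrans p p hp)

/-- If `T` has length `a + b`, with `a` and `b` coprime, agrees with its shift by `a` on the first
`b - 2` positions, and ends with its prefix of length `a`, then it has a bidirectional scheme with
four phrases. -/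
theorem bidirectionalSize_le_four {α : Type} {T : List α} {a b : ℕ} (ha : 1 ≤ a) (hb : 3 ≤ b)
    (hab : a.Coprime b) (hT : T.length = a + b)
    (hshift : ∀ i, i + 2 < b → T[i + a]? = T[i]?) (hborder : ∀ i < a, T[b + i]? = T[i]?) :
    bidirectionalSize T ≤ 4 := by
  refine bidirectionalSize_le (T := T)
    { size := 4
      start := ![0, b - 2, b - 1, b]
      len := ![b - 2, 1, 1, a]
      source := ![some a, none, none, some 0]
      one_le_len := ?_
      start_add_len_le := ?_
      partition := ?_
      len_explicit := ?_
      source_ne := ?_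
      source_add_len_le := ?_
      copy := ?_
      acyclic := ?_ }
  · intro i; fin_cases i <;> simp <;> omega
  · intro i; fin_cases i <;> simp <;> omega
  · intro p hp
    rcases (by omega : p < b - 2 ∨ p = b - 2 ∨ p = b - 1 ∨ b ≤ p) with h | h | h | h
    · refine ⟨0, by simp; omega, fun i hi => ?_⟩
      fin_cases i <;> simp at hi ⊢ <;> omega
    · refine ⟨1, by simp; omega, fun i hi => ?_⟩
      fin_cases i <;> simp at hi ⊢ <;> omega
    · refine ⟨2, by simp; omega, fun i hi => ?_⟩
      fin_cases i <;> simp at hi ⊢ <;> omega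
    · refine ⟨3, by simp; omega, fun i hi => ?_⟩
      fin_cases i <;> simp at hi ⊢ <;> omega
  · intro i; fin_cases i <;> simp
  · intro i s; fin_cases i <;> simp <;> omega
  · intro i s; fin_cases i <;> simp <;> omega
  · intro i s h j hj
    fin_cases i <;> simp at h hj ⊢ <;> subst h
    · rw [add_comm, hshift j (by omega)]
    · rw [zero_add, hborder j hj]
  -- The first phrase sends `x` to `x + a`, the last sends `x` to `x - b`, and these agree modulo `a
  -- + b`. The explicit position `b - 2` has no outgoing edge.
  · refine rotation_acyclic (a := a) (n := a + b) (c := b - 2) (by omega) (by simpa using hab)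
      (by omega) ?_
    rintro x y ⟨i, s, j, h, hj, rfl, rfl⟩
    fin_cases i <;> simp at h hj ⊢ <;> subst h
    · exact ⟨by omega, by omega, by ring⟩
    · refine ⟨by omega, by omega, ?_⟩
      have : ((a + b : ℕ) : ZMod (a + b)) = 0 := ZMod.natCast_self _
      push_cast at this ⊢
      linear_combination -this

theorem bidirectionalSize_fibWord_le {k : ℕ} (hk : 5 ≤ k) :
    bidirectionalSize (fibWord k) ≤ 4 := by
  obtain ⟨m, rfl⟩ := Nat.exists_eq_add_of_le' (show 2 ≤ k by omega)
  have f1 : Nat.fib (m + 2) = Nat.fib m + Nat.fib (m + 1) := Nat.fib_add_two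
  have h2 := two_le_fib (show 3 ≤ m by omega)
  have h3 : Nat.fib 4 ≤ Nat.fib (m + 1) := Nat.fib_mono (by omega)
  refine bidirectionalSize_le_four (a := Nat.fib m) (b := Nat.fib (m + 1)) (by omega) h3
    (Nat.fib_coprime_fib_succ m) (by rw [fibWord_length, f1]) (fun i hi => ?_) fun i hi => ?_
  · rw [fibWord_getElem? (by omega) (by omega), fibWord_getElem? (by omega) (by omega),
      fibLetter_add_fib (by omega) hi]
  · rw [fibWord_getElem? (by omega) (by omega), fibWord_getElem? (by omega) (by omega),
      fibLetter_fib_succ_add (by omega) hi]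

/-! ### The separation -/

theorem bidirectionalSize_fibWord_le_four (k : ℕ) : bidirectionalSize (fibWord k) ≤ 4 := by
  rcases lt_or_ge k 5 with hk | hk
  · refine (bidirectionalSize_le_length _).trans ?_
    rw [fibWord_length]
    exact (Nat.fib_mono (show k ≤ 4 by omega)).trans (by decide)
  · exact bidirectionalSize_fibWord_le hk

theorem lexParseSize_fibWord_le_four {k : ℕ} (he : Even k) : lexParseSize (fibWord k) ≤ 4 := by
  rcases lt_or_ge k 5 with hk | hk
  · refine (lexParseSize_le_length _).trans ?_
    rw [fibWord_length]
    exact (Nat.fib_mono (show k ≤ 4 by omega)).trans (by decide)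
  · exact lexParseSize_fibWord_le hk he

theorem infinite_fibWord_even : (fibWord '' {k | 1 ≤ k ∧ Even k}).Infinite := by
  refine Set.infinite_of_injective_forall_mem (f := fun m : ℕ => fibWord (2 * m + 2)) ?_
    fun m => ⟨2 * m + 2, ⟨by omega, by simp [Nat.even_add]⟩, rfl⟩
  intro m m' h
  have h1 := congrArg List.length h
  simp only [fibWord_length] at h1
  have := Nat.fib_add_two_strictMono.injective h1
  omega

theorem CollageSystem.mul_log_length_le_size {S : CollageSystem (Fin 2)} {k c : ℕ}
    (h : S.Generates (fibWord k)) (hc : c ≤ 4) :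
    1 / 20 * ((c : ℝ) * Real.log ((fibWord k).length : ℝ)) ≤ (S.size : ℝ) := by
  have h1 := CollageSystem.log_length_le_size h
  have h2 : (0 : ℝ) ≤ Real.log ((fibWord k).length : ℝ) := Real.log_natCast_nonneg _
  have h3 : (c : ℝ) ≤ 4 := by exact_mod_cast hc
  have h4 := mul_le_mul_of_nonneg_right h3 h2
  linarith

theorem theorem19 :
    -- the even Fibonacci words form an infinite family
    (fibWord '' {k | 1 ≤ k ∧ Even k}).Infinite ∧
    -- c = Ω(log n) on all Fibonacci words
    (∃ δ : ℝ, 0 < δ ∧ ∀ k, 1 ≤ k → ∀ S : CollageSystem (Fin 2), S.Generates (fibWord k) →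
      δ * Real.log ((fibWord k).length : ℝ) ≤ (S.size : ℝ)) ∧
    -- b = O(1) on all Fibonacci words
    (∃ C : ℕ, ∀ k, 1 ≤ k → bidirectionalSize (fibWord k) ≤ C) ∧
    -- v = O(1) on the even Fibonacci words
    (∃ C : ℕ, ∀ k, 1 ≤ k → Even k → lexParseSize (fibWord k) ≤ C) ∧
    -- c = Ω(v log n) and c = Ω(b log n) on the even Fibonacci words
    (∃ δ : ℝ, 0 < δ ∧ ∀ k, 1 ≤ k → Even k →
      ∀ S : CollageSystem (Fin 2), S.Generates (fibWord k) →
        δ * ((lexParseSize (fibWord k) : ℝ) * Real.log ((fibWord k).length : ℝ))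
            ≤ (S.size : ℝ) ∧
        δ * ((bidirectionalSize (fibWord k) : ℝ) * Real.log ((fibWord k).length : ℝ))
            ≤ (S.size : ℝ)) := by
  exact ⟨infinite_fibWord_even,
    ⟨1 / 5, by norm_num, fun _ _ _ h => CollageSystem.log_length_le_size h⟩,
    ⟨4, fun k _ => bidirectionalSize_fibWord_le_four k⟩,
    ⟨4, fun _ _ he => lexParseSize_fibWord_le_four he⟩,
    ⟨1 / 20, by norm_num, fun k _ he _ h =>
      ⟨CollageSystem.mul_log_length_le_size h (lexParseSize_fibWord_le_four he),
        CollageSystem.mul_log_length_le_size h (bidirectionalSize_fibWord_le_four k)⟩⟩⟩
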